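/- Let $\Sigma=(\sigma_{ij})$ be a known symmetric positive definite $3\times 3$ matrix and let $\alpha\in(0,1)$. One observes $T=(T_{AR},T_{LM},T_{FS})\sim N(\mu,\Sigma)$, where the unknown mean $\mu=(\mu_1,\mu_2,\mu_3)$ ranges over $\mathcal M=\{\mu\in\mathbb R^3:\ \mu_1>0,\ \mu_3>0,\ \mu_2^2<\mu_1\mu_3\}$. Consider testing $H_0:\mu\in\mathcal M,\ \mu_2=0$ against $H_1:\mu\in\mathcal M,\ \mu_2\neq 0$. A test is a measurable function $\varphi:\mathbb R^3\to[0,1]$, where $\varphi(T)$ is the probability of rejecting $H_0$ given the three statistics. It is an unbiased level-$\alpha$ test if $E_\mu[\varphi(T)]\le\alpha$ for every $\mu\in H_0$ and $E_\mu[\varphi(T)]\ge\alpha$ for every $\mu\in H_1$. It is uniformly most powerful unbiased (UMPU) at level $\alpha$ if it is an unbiased level-$\alpha$ test and, for every unbiased level-$\alpha$ test $\psi$ and every $\mu\in H_1$, $E_\mu[\psi(T)]\le E_\mu[\varphi(T)]$. Let $\Phi$ be the standard normal distribution function. Then the two-sided LM test, which rejects $H_0$ if and only if $T_{LM}^2/\sigma_{22}>\Phi^{-1}(1-\alpha/2)^2$,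 is the UMPU test at level $\alpha$: it is a UMPU test, its rejection probability equals $\alpha$ at every $\mu\in H_0$, and every UMPU test at level $\alpha$ coincides with it $N(\mu,\Sigma)$-almost surely for every $\mu\in\mathcal M$. -/

import Mathlib

open MeasureTheory ProbabilityTheory

namespace UMPU

noncomputable section

/-- A (possibly randomized) test based on an observation in `X`: a measurable critical function
with values in `[0, 1]`; `φ x` is the probability of rejecting the null when `x` is observed. -/
structure IsTest {X : Type*} [MeasurableSpace X] (φ : X → ℝ) : Prop where
  measurable : Measurable φ
  mem_Icc : ∀ x, φ x ∈ Set.Icc (0 : ℝ) 1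

/-- The rejection probability (power function) of `φ` at the parameter `θ` in the statistical
model `P`. -/
def power {Θ X : Type*} [MeasurableSpace X] (P : Θ → Measure X) (φ : X → ℝ) (θ : Θ) : ℝ :=
  ∫ x, φ x ∂(P θ)

/-- `φ` is an unbiased level-`α` test of the null `H₀` against the alternative `H₁`: its rejection
probability is at most `α` on the null and at least `α` on the alternative. -/
structure IsUnbiasedTest {Θ X : Type*} [MeasurableSpace X] (P : Θ → Measure X) (H₀ H₁ : Set Θ)
    (α : ℝ) (φ : X → ℝ) : Prop where
  isTest : IsTest φ
  level : ∀ θ ∈ H₀, power P φ θ ≤ α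
  unbiased : ∀ θ ∈ H₁, α ≤ power P φ θ

/-- `φ` is a uniformly most powerful unbiased level-`α` test of `H₀` against `H₁`: it is unbiased,
and at every point of the alternative no unbiased level-`α` test has larger power. -/
structure IsUMPUTest {Θ X : Type*} [MeasurableSpace X] (P : Θ → Measure X) (H₀ H₁ : Set Θ)
    (α : ℝ) (φ : X → ℝ) : Prop where
  isUnbiasedTest : IsUnbiasedTest P H₀ H₁ α φ
  most_powerful : ∀ ψ : X → ℝ, IsUnbiasedTest P H₀ H₁ α ψ →
    ∀ θ ∈ H₁, power P ψ θ ≤ power P φ θ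

/-- The `p`-quantile of the standard normal distribution. -/
def normalQuantile (p : ℝ) : ℝ := sInf {x : ℝ | p ≤ cdf (gaussianReal 0 1) x}

/-- The interior `{μ : μ₁ > 0, μ₃ > 0, μ₂² < μ₁ μ₃}` of the space of means
(coordinates `0, 1, 2` stand for `1, 2, 3`). -/
def interiorMeans : Set (EuclideanSpace ℝ (Fin 3)) :=
  {μ | 0 < μ 0 ∧ 0 < μ 2 ∧ (μ 1) ^ 2 < μ 0 * μ 2}

/-- The null hypothesis `μ₂ = 0` in the interior. -/
def nullMeans : Set (EuclideanSpace ℝ (Fin 3)) := {μ | μ ∈ interiorMeans ∧ μ 1 = 0}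

/-- The two-sided alternative `μ₂ ≠ 0` in the interior. -/
def altMeans : Set (EuclideanSpace ℝ (Fin 3)) := {μ | μ ∈ interiorMeans ∧ μ 1 ≠ 0}

/-- The limiting Gaussian model: the observation `T = (T_AR, T_LM, T_FS)` has law `N(μ, S)`,
indexed by its mean `μ`, with known covariance matrix `S`. -/
def gaussianModel (S : Matrix (Fin 3) (Fin 3) ℝ) (μ : EuclideanSpace ℝ (Fin 3)) :
    Measure (EuclideanSpace ℝ (Fin 3)) :=
  multivariateGaussian μ S

open scoped Classical in
/-- The two-sided LM test: reject when `T_LM² / σ₂₂` exceeds the square of the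
`1 - α / 2` standard normal quantile. -/
def lmTest (S : Matrix (Fin 3) (Fin 3) ℝ) (α : ℝ) (t : EuclideanSpace ℝ (Fin 3)) : ℝ :=
  if normalQuantile (1 - α / 2) ^ 2 < (t 1) ^ 2 / S 1 1 then 1 else 0

end

end UMPU

/-! Write `Y` for `T_LM / √σ₂₂`. By completing the square, tilting `N(ν, S)` by `exp ⟪θ, t⟫` moves
its mean to `ν + S θ` (`multivariateGaussian_add_eq_tilted`). Tilting by `s * Y` thus moves the mean
along `ν + s • scoreShift S`, and every `μ` lies on such a line through some `ν` with `ν 1 = 0`,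
where `Y ~ N(0, 1)`.

Along the line through a null point, the power of an unbiased test is at least `α` nearby and at
most `α` at the point itself, which gives `E_ν[ψ] = α` and `E_ν[ψ Y] = 0`. Both expectations are, up
to positive or additive terms, analytic along lines, so the two conditions spread to the whole plane
`ν 1 = 0` (`IsUnbiasedTest.integral_of_apply_one_eq_zero`).

Under these conditions, `integral_mul_exp_le_of_two_sided` shows that the LM test maximizes `E_ν[ψ
exp (s * Y)]`, uniquely almost everywhere. No conditioning on the other statistics is needed.
Uniqueness passes to all means because the laws are mutually absolutely continuous. -/

namespace UMPU

open Real Filter Topology Set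
open scoped RealInnerProductSpace

/-! ### Exponential tilting of multivariate Gaussians -/

section Gaussian

variable {ι : Type*} [Fintype ι] [DecidableEq ι] {S : Matrix ι ι ℝ}

lemma map_inner_multivariateGaussian (hS : S.PosSemidef) (ν u : EuclideanSpace ℝ ι) :
    (multivariateGaussian ν S).map (fun t ↦ ⟪u, t⟫) =
      gaussianReal ⟪u, ν⟫ (⟪u, Matrix.toEuclideanCLM (𝕜 := ℝ) S u⟫).toNNReal := by
  have h := IsGaussian.map_eq_gaussianReal (μ := multivariateGaussian ν S) (innerSL ℝ u)
  rw [(innerSL ℝ u).integral_comp_comm IsGaussian.integrable_fun_id,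
    integral_id_multivariateGaussian] at h
  have h2 : Var[innerSL ℝ u; multivariateGaussian ν S] =
      ⟪u, Matrix.toEuclideanCLM (𝕜 := ℝ) S u⟫ := by
    rw [← covariance_self (by fun_prop)]
    have := covarianceBilin_apply_eq_cov (μ := multivariateGaussian ν S) IsGaussian.memLp_two_id u u
    rw [covarianceBilin_multivariateGaussian hS] at this
    rw [Matrix.inner_toEuclideanCLM, this]
    rfl
  rw [h2] at h
  simpa using h

lemma mgf_inner_multivariateGaussian (hS : S.PosSemidef) (ν u : EuclideanSpace ℝ ι) (s : ℝ) :
    mgf (fun t ↦ ⟪u, t⟫) (multivariateGaussian ν S) s =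
      exp (s * ⟪u, ν⟫ + s ^ 2 * ⟪u, Matrix.toEuclideanCLM (𝕜 := ℝ) S u⟫ / 2) := by
  rw [mgf_gaussianReal (map_inner_multivariateGaussian hS ν u), Real.coe_toNNReal]
  · ring_nf
  · rw [Matrix.inner_toEuclideanCLM]
    simpa using hS.dotProduct_mulVec_nonneg u.ofLp

lemma integral_exp_inner_multivariateGaussian (hS : S.PosSemidef) (ν u : EuclideanSpace ℝ ι) :
    ∫ t, exp ⟪u, t⟫ ∂(multivariateGaussian ν S) =
      exp (⟪u, ν⟫ + ⟪u, Matrix.toEuclideanCLM (𝕜 := ℝ) S u⟫ / 2) := by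
  simpa [mgf] using mgf_inner_multivariateGaussian hS ν u 1

lemma integrable_exp_inner_multivariateGaussian (hS : S.PosSemidef) (ν u : EuclideanSpace ℝ ι) :
    Integrable (fun t ↦ exp ⟪u, t⟫) (multivariateGaussian ν S) := by
  -- A non-integrable function has integral 0 by convention, but this integral is an exponential.
  by_contra h
  have := integral_exp_inner_multivariateGaussian hS ν u
  rw [integral_undef h] at this
  exact (exp_pos _).ne this

/-- Two probability measures whose linear functionals have the same, everywhere finite, moment
generating functions are equal. -/
lemma ext_of_mgf_inner {E : Type*} [NormedAddCommGroup E] [InnerProductSpace ℝ E]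
    [CompleteSpace E] [SecondCountableTopology E] [MeasurableSpace E] [BorelSpace E]
    {P Q : Measure E} [IsProbabilityMeasure P] [IsProbabilityMeasure Q]
    (hP : ∀ u : E, Integrable (fun t ↦ exp ⟪u, t⟫) P)
    (h : ∀ u : E, ∫ t, exp ⟪u, t⟫ ∂P = ∫ t, exp ⟪u, t⟫ ∂Q) : P = Q := by
  apply Measure.ext_of_charFun
  ext u
  have hset : integrableExpSet (fun t ↦ ⟪u, t⟫) P = univ := by
    ext s
    simpa [integrableExpSet, real_inner_smul_left] using hP (s • u)
  have hm : mgf (fun t ↦ ⟪u, t⟫) P = mgf (fun t ↦ ⟪u, t⟫) Q := by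
    ext s
    simpa [mgf, real_inner_smul_left] using h (s • u)
  -- The mgf determines its analytic extension, whose value at `I` is the characteristic function.
  have := eqOn_complexMGF_of_mgf hm (x := Complex.I) (by simp [hset])
  simp only [charFun_apply, complexMGF] at this ⊢
  simpa [mul_comm, real_inner_comm] using this

/-- Both sides have the same moment generating function; the cross terms match because `S` is
symmetric. Working with mgfs avoids densities and invertibility of `S`. -/
lemma multivariateGaussian_add_eq_tilted (hS : S.PosSemidef) (ν θ : EuclideanSpace ℝ ι) :
    multivariateGaussian (ν + Matrix.toEuclideanCLM (𝕜 := ℝ) S θ) S =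
      (multivariateGaussian ν S).tilted (fun t ↦ ⟪θ, t⟫) := by
  have : IsProbabilityMeasure ((multivariateGaussian ν S).tilted (fun t ↦ ⟪θ, t⟫)) :=
    isProbabilityMeasure_tilted (integrable_exp_inner_multivariateGaussian hS ν θ)
  refine ext_of_mgf_inner (fun u ↦ integrable_exp_inner_multivariateGaussian hS _ u) fun u ↦ ?_
  rw [integral_exp_inner_multivariateGaussian hS, integral_tilted,
    integral_exp_inner_multivariateGaussian hS]
  simp_rw [smul_eq_mul, div_mul_eq_mul_div, ← exp_add, ← inner_add_left]
  rw [integral_div, integral_exp_inner_multivariateGaussian hS, ← exp_sub]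
  congr 1
  have : ⟪θ, Matrix.toEuclideanCLM (𝕜 := ℝ) S u⟫ = ⟪u, Matrix.toEuclideanCLM (𝕜 := ℝ) S θ⟫ := by
    rw [Matrix.inner_toEuclideanCLM, Matrix.inner_toEuclideanCLM, Matrix.dotProduct_mulVec,
      ← Matrix.mulVec_transpose, dotProduct_comm]
    have := hS.isHermitian.eq
    rw [Matrix.conjTranspose_eq_transpose_of_trivial] at this
    rw [this]
  simp only [map_add, inner_add_left, inner_add_right, this]
  ring

lemma integral_multivariateGaussian_add (hS : S.PosSemidef) (ν θ : EuclideanSpace ℝ ι)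
    (g : EuclideanSpace ℝ ι → ℝ) :
    ∫ t, g t ∂(multivariateGaussian (ν + Matrix.toEuclideanCLM (𝕜 := ℝ) S θ) S) =
      (∫ t, g t * exp ⟪θ, t⟫ ∂(multivariateGaussian ν S)) /
        ∫ t, exp ⟪θ, t⟫ ∂(multivariateGaussian ν S) := by
  rw [multivariateGaussian_add_eq_tilted hS, integral_tilted, ← integral_div]
  congr 1 with t
  rw [smul_eq_mul]
  ring

end Gaussian

/-! ### Analyticity of weighted exponential integrals -/

section Analytic

variable {Ω : Type*} {mΩ : MeasurableSpace Ω} {P : Measure Ω} {X : Ω → ℝ}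

/-- Absorbing a nonnegative weight into the measure turns the weighted integral into an mgf, so
analyticity and derivatives come from mgf theory. -/
lemma mgf_withDensity {f : Ω → ℝ} (hf : Measurable f) (hf0 : ∀ ω, 0 ≤ f ω) (s : ℝ) :
    mgf X (P.withDensity fun ω ↦ ENNReal.ofReal (f ω)) s = ∫ ω, f ω * exp (s * X ω) ∂P := by
  rw [mgf, integral_withDensity_eq_integral_toReal_smul (by fun_prop) (by simp)]
  simp [hf0]

lemma integrableExpSet_withDensity {f : Ω → ℝ} (hf : Measurable f) (hf0 : ∀ ω, 0 ≤ f ω)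
    (h : ∀ s, Integrable (fun ω ↦ f ω * exp (s * X ω)) P) :
    integrableExpSet X (P.withDensity fun ω ↦ ENNReal.ofReal (f ω)) = univ := by
  ext s
  simp only [integrableExpSet, mem_ofPred_eq, mem_univ, iff_true]
  rw [integrable_withDensity_iff_integrable_smul' (by fun_prop) (by simp)]
  simpa [hf0] using h s

lemma analyticOnNhd_integral_mul_exp_of_nonneg {f : Ω → ℝ} (hf : Measurable f)
    (hf0 : ∀ ω, 0 ≤ f ω) (h : ∀ s, Integrable (fun ω ↦ f ω * exp (s * X ω)) P) :
    AnalyticOnNhd ℝ (fun s ↦ ∫ ω, f ω * exp (s * X ω) ∂P) univ := by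
  have := analyticOnNhd_mgf (X := X) (μ := P.withDensity fun ω ↦ ENNReal.ofReal (f ω))
  rw [integrableExpSet_withDensity hf hf0 h, interior_univ] at this
  simpa only [← mgf_withDensity hf hf0] using this

lemma hasDerivAt_integral_mul_exp {f : Ω → ℝ} (hf : Measurable f)
    (hf0 : ∀ ω, 0 ≤ f ω) (h : ∀ s, Integrable (fun ω ↦ f ω * exp (s * X ω)) P) :
    HasDerivAt (fun s ↦ ∫ ω, f ω * exp (s * X ω) ∂P) (∫ ω, f ω * X ω ∂P) 0 := by
  have := hasDerivAt_mgf (X := X) (μ := P.withDensity fun ω ↦ ENNReal.ofReal (f ω)) (t := 0)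
  rw [integrableExpSet_withDensity hf hf0 h, interior_univ,
    integral_withDensity_eq_integral_toReal_smul (by fun_prop) (by simp)] at this
  have := this (mem_univ _)
  simp only [zero_mul, exp_zero, mul_one, ENNReal.toReal_ofReal (hf0 _), smul_eq_mul] at this
  rwa [funext (mgf_withDensity (X := X) (P := P) hf hf0)] at this

lemma analyticOnNhd_integral_mul_exp {g : Ω → ℝ} (hg : Measurable g) (hX : Measurable X)
    (h : ∀ s, Integrable (fun ω ↦ g ω * exp (s * X ω)) P) :
    AnalyticOnNhd ℝ (fun s ↦ ∫ ω, g ω * exp (s * X ω) ∂P) univ := by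
  have hp : ∀ s, Integrable (fun ω ↦ max (g ω) 0 * exp (s * X ω)) P := fun s ↦
    (h s).mono (by fun_prop) <| ae_of_all _ fun ω ↦ by
      simp only [norm_mul]
      gcongr
      rw [norm_eq_abs, norm_eq_abs, abs_of_nonneg (le_max_right _ _)]
      exact max_le (le_abs_self _) (abs_nonneg _)
  have hn : ∀ s, Integrable (fun ω ↦ max (-g ω) 0 * exp (s * X ω)) P := fun s ↦
    (h s).mono (by fun_prop) <| ae_of_all _ fun ω ↦ by
      simp only [norm_mul]
      gcongr
      rw [norm_eq_abs, norm_eq_abs, abs_of_nonneg (le_max_right _ _)]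
      exact max_le (neg_le_abs _) (abs_nonneg _)
  -- A signed weight is the difference of its positive and negative parts.
  have := (analyticOnNhd_integral_mul_exp_of_nonneg (by fun_prop) (fun _ ↦ le_max_right _ _) hp).sub
    (analyticOnNhd_integral_mul_exp_of_nonneg (by fun_prop) (fun _ ↦ le_max_right _ _) hn)
  refine this.congr isOpen_univ fun s _ ↦ ?_
  simp only [Pi.sub_apply]
  rw [← integral_sub (hp s) (hn s)]
  congr 1 with ω
  rw [← sub_mul]
  congr 1
  rcases le_total (g ω) 0 with h0 | h0 <;> simp [h0]

lemma integral_mul_exp_eq_zero {g : Ω → ℝ} (hg : Measurable g) (hX : Measurable X)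
    (h : ∀ s, Integrable (fun ω ↦ g ω * exp (s * X ω)) P)
    (h0 : ∀ᶠ s in 𝓝 (0 : ℝ), ∫ ω, g ω * exp (s * X ω) ∂P = 0) (s : ℝ) :
    ∫ ω, g ω * exp (s * X ω) ∂P = 0 :=
  (analyticOnNhd_integral_mul_exp hg hX h).eqOn_zero_of_preconnected_of_eventuallyEq_zero
    isPreconnected_univ (mem_univ 0) h0 (mem_univ s)

end Analytic

/-! ### Standard normal quantiles -/

section StandardNormal

lemma continuous_cdf_of_noAtoms (P : Measure ℝ) [IsProbabilityMeasure P]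
    (h : ∀ x, P {x} = 0) : Continuous (cdf P) := by
  refine continuous_iff_continuousAt.2 fun x ↦ ?_
  rw [(cdf P).mono.continuousAt_iff_leftLim_eq_rightLim, StieltjesFunction.rightLim_eq]
  have := h x
  rw [← measure_cdf P, StieltjesFunction.measure_singleton, ENNReal.ofReal_eq_zero] at this
  exact le_antisymm ((cdf P).mono.leftLim_le le_rfl) (by linarith)

lemma gaussianReal_singleton (x : ℝ) : gaussianReal 0 1 {x} = 0 := by
  have := nullSingletonClass_gaussianReal (μ := 0) (v := 1) one_ne_zero
  exact measure_singleton x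

lemma cdf_normalQuantile {p : ℝ} (h0 : 0 < p) (h1 : p < 1) :
    cdf (gaussianReal 0 1) (normalQuantile p) = p := by
  have hc := continuous_cdf_of_noAtoms (gaussianReal 0 1) gaussianReal_singleton
  set F := cdf (gaussianReal 0 1)
  obtain ⟨a, ha⟩ := ((tendsto_cdf_atBot (gaussianReal 0 1)).eventually_lt_const h0).exists
  obtain ⟨b, hb⟩ := ((tendsto_cdf_atTop (gaussianReal 0 1)).eventually_const_lt h1).exists
  have hbdd : BddBelow {x : ℝ | p ≤ F x} :=
    ⟨a, fun x hx ↦ le_of_not_gt fun hxa ↦ by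
      have := monotone_cdf (gaussianReal 0 1) hxa.le
      have hx : p ≤ F x := hx
      exact absurd (hx.trans this) (not_le.2 ha)⟩
  have hmem : normalQuantile p ∈ {x : ℝ | p ≤ F x} :=
    (isClosed_le continuous_const hc).csInf_mem ⟨b, hb.le⟩ hbdd
  refine le_antisymm ?_ hmem
  -- Strictly left of the infimum the cdf is below `p`; continuity carries the bound to the limit.
  refine le_of_tendsto (hc.continuousAt.tendsto.mono_left nhdsWithin_le_nhds : Tendsto F
    (𝓝[<] normalQuantile p) _) ?_
  filter_upwards [self_mem_nhdsWithin] with x hx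
  refine le_of_not_ge fun hp ↦ ?_
  exact absurd (csInf_le hbdd (show x ∈ {x : ℝ | p ≤ F x} from hp)) (not_le.2 hx)

lemma gaussianReal_neg_preimage (s : Set ℝ) (hs : MeasurableSet s) :
    (gaussianReal 0 1).real ((fun x ↦ -x) ⁻¹' s) = (gaussianReal 0 1).real s := by
  have := gaussianReal_map_neg (μ := 0) (v := 1)
  rw [neg_zero] at this
  conv_rhs => rw [← this]
  rw [map_measureReal_apply measurable_neg hs]

lemma gaussianReal_real_Ioi (x : ℝ) :
    (gaussianReal 0 1).real (Ioi x) = 1 - cdf (gaussianReal 0 1) x := by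
  rw [cdf_eq_real, ← compl_Iic, probReal_compl_eq_one_sub measurableSet_Iic]

lemma gaussianReal_real_Iio (x : ℝ) :
    (gaussianReal 0 1).real (Iio (-x)) = 1 - cdf (gaussianReal 0 1) x := by
  rw [← gaussianReal_real_Ioi, ← gaussianReal_neg_preimage _ measurableSet_Ioi]
  congr 1
  ext y
  simp

lemma normalQuantile_pos {p : ℝ} (h0 : 1 / 2 < p) (h1 : p < 1) : 0 < normalQuantile p := by
  have hz : cdf (gaussianReal 0 1) 0 = 1 / 2 := by
    have h := gaussianReal_real_Iio 0
    have h2 : (gaussianReal 0 1).real (Iio (-0)) = cdf (gaussianReal 0 1) 0 := by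
      rw [cdf_eq_real, neg_zero]
      have := nullSingletonClass_gaussianReal (μ := 0) (v := 1) one_ne_zero
      exact measureReal_congr Iio_ae_eq_Iic
    linarith
  refine lt_of_not_ge fun h ↦ ?_
  have := monotone_cdf (gaussianReal 0 1) h
  rw [cdf_normalQuantile (by linarith) h1] at this
  linarith

lemma gaussianReal_real_sq_gt {α : ℝ} (hα₀ : 0 < α) (hα₁ : α < 1) :
    (gaussianReal 0 1).real {y | normalQuantile (1 - α / 2) ^ 2 < y ^ 2} = α := by
  have hq : 0 < normalQuantile (1 - α / 2) := normalQuantile_pos (by linarith) (by linarith)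
  have hF : cdf (gaussianReal 0 1) (normalQuantile (1 - α / 2)) = 1 - α / 2 :=
    cdf_normalQuantile (by linarith) (by linarith)
  set q := normalQuantile (1 - α / 2)
  have : {y : ℝ | q ^ 2 < y ^ 2} = Iio (-q) ∪ Ioi q := by
    ext y
    simp only [mem_ofPred_eq, mem_union, mem_Iio, mem_Ioi]
    rw [sq_lt_sq, abs_of_pos hq, lt_abs, lt_neg, or_comm]
  rw [this, measureReal_union _ measurableSet_Ioi, gaussianReal_real_Ioi, gaussianReal_real_Iio, hF]
  · ring
  · exact Set.disjoint_left.2 fun y hy hy' ↦ by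
      simp only [mem_Iio, mem_Ioi] at hy hy'
      linarith

end StandardNormal

/-! ### A generalized Neyman–Pearson lemma -/

section NeymanPearson

/-- The exponential lies above its chord through `±q` exactly outside of `[-q, q]`. -/
lemma exists_chord_exp {q m : ℝ} (hq : 0 < q) (hm : m ≠ 0) :
    ∃ a b : ℝ, ∀ y, (q ^ 2 < y ^ 2 → a + b * y < exp (m * y)) ∧
      (y ^ 2 < q ^ 2 → exp (m * y) < a + b * y) := by
  have hconv : StrictConvexOn ℝ univ fun y ↦ exp (m * y) := by
    refine ⟨convex_univ, fun x _ y _ hxy a b ha hb hab ↦ ?_⟩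
    have := strictConvexOn_exp.2 (mem_univ (m * x)) (mem_univ (m * y))
      (fun h ↦ hxy (mul_left_cancel₀ hm h)) ha hb hab
    simp only [smul_eq_mul] at this ⊢
    convert this using 2
    ring
  set A := exp (m * q) with hA
  set B := exp (m * (-q)) with hB
  -- Clearing the denominator `2 * q` puts the chord in the form of the secant inequality.
  have hchord (y : ℝ) : 2 * q * ((A + B) / 2 + (A - B) / (2 * q) * y) =
      q * (A + B) + (A - B) * y := by
    field_simp
  refine ⟨(A + B) / 2, (A - B) / (2 * q), fun y ↦ ⟨fun h ↦ ?_, fun h ↦ ?_⟩⟩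
  · rw [sq_lt_sq, abs_of_pos hq, lt_abs] at h
    have key : 2 * q * ((A + B) / 2 + (A - B) / (2 * q) * y) < 2 * q * exp (m * y) := by
      rcases h with h | h
      · have := hconv.secant_strict_mono_aux1 (mem_univ (-q)) (mem_univ y) (by linarith) h
        simp only [← hA, ← hB] at this
        rw [hchord]
        linarith
      · have := hconv.secant_strict_mono_aux1 (mem_univ y) (mem_univ q)
          (show y < -q by linarith) (by linarith)
        simp only [← hA, ← hB] at this
        rw [hchord]
        linarith
    exact lt_of_mul_lt_mul_left key (by positivity)
  · rw [sq_lt_sq, abs_of_pos hq, abs_lt] at h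
    have key : 2 * q * exp (m * y) < 2 * q * ((A + B) / 2 + (A - B) / (2 * q) * y) := by
      have := hconv.secant_strict_mono_aux1 (mem_univ (-q)) (mem_univ q) h.1 h.2
      simp only [← hA, ← hB] at this
      rw [hchord]
      linarith
    exact lt_of_mul_lt_mul_left key (by positivity)

variable {Ω : Type*} {mΩ : MeasurableSpace Ω} {P : Measure Ω}

lemma IsTest.integrable_mul {φ g : Ω → ℝ} (hφ : IsTest φ) (hg : Integrable g P) :
    Integrable (fun ω ↦ φ ω * g ω) P :=
  hg.bdd_mul hφ.measurable.aestronglyMeasurable (ae_of_all _ fun ω ↦ by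
    rw [norm_eq_abs, abs_of_nonneg (hφ.mem_Icc ω).1]
    exact (hφ.mem_Icc ω).2)

lemma IsTest.integrable [IsFiniteMeasure P] {φ : Ω → ℝ} (hφ : IsTest φ) : Integrable φ P := by
  simpa using hφ.integrable_mul (integrable_const (μ := P) (1 : ℝ))

variable [IsProbabilityMeasure P] {Y : Ω → ℝ} {φ ψ : Ω → ℝ} {q m : ℝ}

/-- Generalized Neyman-Pearson lemma: under two side conditions, the two-sided test has the largest
mean with respect to the exponential weight `exp (m * Y)`, and is essentially the only such test. -/
lemma integral_mul_exp_le_of_two_sided (hφ : IsTest φ) (hψ : IsTest ψ) (hq : 0 < q) (hm : m ≠ 0)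
    (hφ1 : ∀ ω, q ^ 2 < Y ω ^ 2 → φ ω = 1) (hφ0 : ∀ ω, Y ω ^ 2 < q ^ 2 → φ ω = 0)
    (hY : ∀ᵐ ω ∂P, Y ω ^ 2 ≠ q ^ 2)
    (hYi : Integrable Y P) (hexp : Integrable (fun ω ↦ exp (m * Y ω)) P)
    (h0 : ∫ ω, ψ ω ∂P = ∫ ω, φ ω ∂P) (h1 : ∫ ω, ψ ω * Y ω ∂P = ∫ ω, φ ω * Y ω ∂P) :
    ∫ ω, ψ ω * exp (m * Y ω) ∂P ≤ ∫ ω, φ ω * exp (m * Y ω) ∂P ∧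
      (∫ ω, ψ ω * exp (m * Y ω) ∂P = ∫ ω, φ ω * exp (m * Y ω) ∂P → ψ =ᵐ[P] φ) := by
  obtain ⟨a, b, hab⟩ := exists_chord_exp hq hm
  have hrep (χ : Ω → ℝ) (hχ : IsTest χ) :
      Integrable (fun ω ↦ χ ω * (exp (m * Y ω) - (a + b * Y ω))) P ∧
      ∫ ω, χ ω * (exp (m * Y ω) - (a + b * Y ω)) ∂P =
        ∫ ω, χ ω * exp (m * Y ω) ∂P - (a * ∫ ω, χ ω ∂P + b * ∫ ω, χ ω * Y ω ∂P) := by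
    have i1 := hχ.integrable_mul hexp
    have i2 := (hχ.integrable (P := P)).const_mul a
    have i3 := (hχ.integrable_mul hYi).const_mul b
    have e : (fun ω ↦ χ ω * (exp (m * Y ω) - (a + b * Y ω))) =
        fun ω ↦ χ ω * exp (m * Y ω) - (a * χ ω + b * (χ ω * Y ω)) := by
      ext ω
      ring
    have i23 : Integrable (fun ω ↦ a * χ ω + b * (χ ω * Y ω)) P := i2.add i3
    rw [e]
    refine ⟨i1.sub i23, ?_⟩
    rw [integral_sub i1 i23, integral_add i2 i3, integral_const_mul, integral_const_mul]
  -- Off the null set `Y² = q²`, `φ - ψ` never has the sign opposite to that of `exp` minus chord.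
  have hnn : ∀ᵐ ω ∂P, 0 ≤ (φ ω - ψ ω) * (exp (m * Y ω) - (a + b * Y ω)) := by
    filter_upwards [hY] with ω hω
    rcases hω.lt_or_gt with h | h
    · rw [hφ0 ω h]
      nlinarith [(hab (Y ω)).2 h, (hψ.mem_Icc ω).1]
    · rw [hφ1 ω h]
      nlinarith [(hab (Y ω)).1 h, (hψ.mem_Icc ω).2]
  obtain ⟨iφ, eφ⟩ := hrep φ hφ
  obtain ⟨iψ, eψ⟩ := hrep ψ hψ
  -- The side conditions make the chord integrate equally against `φ` and `ψ`, so it cancels.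
  have hint : ∫ ω, (φ ω - ψ ω) * (exp (m * Y ω) - (a + b * Y ω)) ∂P =
      ∫ ω, φ ω * exp (m * Y ω) ∂P - ∫ ω, ψ ω * exp (m * Y ω) ∂P := by
    simp_rw [sub_mul]
    rw [integral_sub iφ iψ, eφ, eψ, h0, h1]
    ring
  refine ⟨by linarith [integral_nonneg_of_ae hnn], fun heq ↦ ?_⟩
  have hi : Integrable (fun ω ↦ (φ ω - ψ ω) * (exp (m * Y ω) - (a + b * Y ω))) P := by
    simp_rw [sub_mul]
    exact iφ.sub iψ
  have hz := (integral_eq_zero_iff_of_nonneg_ae hnn hi).1 (by rw [hint, heq, sub_self])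
  filter_upwards [hz, hY] with ω hω hω'
  have hne : exp (m * Y ω) - (a + b * Y ω) ≠ 0 := by
    rcases hω'.lt_or_gt with h | h
    · exact (sub_neg.2 ((hab (Y ω)).2 h)).ne
    · exact (sub_pos.2 ((hab (Y ω)).1 h)).ne'
  exact (sub_eq_zero.1 ((mul_eq_zero.1 hω).resolve_right hne)).symm

end NeymanPearson

/-! ### The Gaussian model and the LM statistic -/

section LMModel

variable {S : Matrix (Fin 3) (Fin 3) ℝ}

/-- The standardized LM statistic is the linear functional `⟪scoreVector S, ·⟫`. -/
noncomputable def scoreVector (S : Matrix (Fin 3) (Fin 3) ℝ) : EuclideanSpace ℝ (Fin 3) :=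
  EuclideanSpace.single 1 (√(S 1 1))⁻¹

/-- The direction in which the mean moves when the model is tilted by the LM statistic. -/
noncomputable def scoreShift (S : Matrix (Fin 3) (Fin 3) ℝ) : EuclideanSpace ℝ (Fin 3) :=
  Matrix.toEuclideanCLM (𝕜 := ℝ) S (scoreVector S)

lemma inner_scoreVector (t : EuclideanSpace ℝ (Fin 3)) :
    ⟪scoreVector S, t⟫ = t 1 / √(S 1 1) := by
  simp [scoreVector, EuclideanSpace.inner_single_left, div_eq_inv_mul]

lemma scoreShift_apply_one (hS : S.PosDef) : scoreShift S 1 = √(S 1 1) := by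
  have h : 0 < S 1 1 := hS.diag_pos
  have hs : √(S 1 1) ≠ 0 := (sqrt_pos.2 h).ne'
  have : scoreShift S 1 = S 1 1 * (√(S 1 1))⁻¹ := by
    simp [scoreShift, scoreVector, Matrix.ofLp_toEuclideanCLM]
  rw [this]
  field_simp
  rw [sq_sqrt h.le]

lemma inner_scoreVector_scoreShift (hS : S.PosDef) : ⟪scoreVector S, scoreShift S⟫ = 1 := by
  have h : 0 < S 1 1 := hS.diag_pos
  rw [inner_scoreVector, scoreShift_apply_one hS, div_self (sqrt_pos.2 h).ne']

lemma map_inner_scoreVector (hS : S.PosDef) {ν : EuclideanSpace ℝ (Fin 3)} (hν : ν 1 = 0) :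
    (gaussianModel S ν).map (fun t ↦ ⟪scoreVector S, t⟫) = gaussianReal 0 1 := by
  rw [gaussianModel, map_inner_multivariateGaussian hS.posSemidef, inner_scoreVector, hν,
    ← scoreShift, inner_scoreVector_scoreShift hS]
  simp

instance (μ : EuclideanSpace ℝ (Fin 3)) : IsProbabilityMeasure (gaussianModel S μ) := by
  unfold gaussianModel
  infer_instance

lemma integrable_exp_gaussianModel (hS : S.PosDef) (ν u : EuclideanSpace ℝ (Fin 3)) :
    Integrable (fun t ↦ exp ⟪u, t⟫) (gaussianModel S ν) :=
  integrable_exp_inner_multivariateGaussian hS.posSemidef ν u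

lemma integrable_exp_mul_gaussianModel (hS : S.PosDef) (ν u : EuclideanSpace ℝ (Fin 3)) (s : ℝ) :
    Integrable (fun t ↦ exp (s * ⟪u, t⟫)) (gaussianModel S ν) := by
  simpa only [real_inner_smul_left] using integrable_exp_gaussianModel hS ν (s • u)

lemma integrable_inner_mul_exp_gaussianModel (hS : S.PosDef)
    (ν v u : EuclideanSpace ℝ (Fin 3)) (s : ℝ) :
    Integrable (fun t ↦ ⟪v, t⟫ * exp (s * ⟪u, t⟫)) (gaussianModel S ν) := by
  -- Domination by `|x| ≤ exp x + exp (-x)`.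
  refine ((integrable_exp_gaussianModel hS ν (v + s • u)).add
    (integrable_exp_gaussianModel hS ν (-v + s • u))).mono (by fun_prop) (ae_of_all _ fun t ↦ ?_)
  simp only [Pi.add_apply, inner_add_left, inner_neg_left, real_inner_smul_left, exp_add, ← add_mul]
  rw [norm_mul, norm_mul]
  refine mul_le_mul_of_nonneg_right ?_ (norm_nonneg _)
  rw [norm_eq_abs, norm_eq_abs,
    abs_of_pos (add_pos (exp_pos ⟪v, t⟫) (exp_pos (-⟪v, t⟫))), abs_le]
  constructor
  · linarith [add_one_le_exp ⟪v, t⟫, add_one_le_exp (-⟪v, t⟫), exp_pos ⟪v, t⟫]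
  · linarith [add_one_le_exp ⟪v, t⟫, add_one_le_exp (-⟪v, t⟫), exp_pos (-⟪v, t⟫)]

lemma integrable_inner_gaussianModel (hS : S.PosDef) (ν v : EuclideanSpace ℝ (Fin 3)) :
    Integrable (fun t ↦ ⟪v, t⟫) (gaussianModel S ν) := by
  simpa using integrable_inner_mul_exp_gaussianModel hS ν v 0 0

lemma power_add_scoreShift (hS : S.PosDef) {ν : EuclideanSpace ℝ (Fin 3)} (hν : ν 1 = 0)
    (ψ : EuclideanSpace ℝ (Fin 3) → ℝ) (s : ℝ) :
    power (gaussianModel S) ψ (ν + s • scoreShift S) =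
      (∫ t, ψ t * exp (s * ⟪scoreVector S, t⟫) ∂(gaussianModel S ν)) / exp (s ^ 2 / 2) := by
  have h := integral_multivariateGaussian_add hS.posSemidef ν (s • scoreVector S) ψ
  rw [integral_exp_inner_multivariateGaussian hS.posSemidef, map_smul, ← scoreShift] at h
  simp only [inner_smul_right, real_inner_smul_left, inner_scoreVector_scoreShift hS] at h
  rw [inner_scoreVector ν, hν] at h
  rw [power, gaussianModel, h]
  congr 2
  ring

/-- Since `S` is invertible, moving along any `d` is a tilt by `S⁻¹ d`; up to a positive factor the
integral is analytic in `s`, and the identity theorem applies. -/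
lemma integral_eq_zero_of_line (hS : S.PosDef) {ν₀ d : EuclideanSpace ℝ (Fin 3)}
    {g : EuclideanSpace ℝ (Fin 3) → ℝ} (hg : Measurable g)
    (hint : ∀ u : EuclideanSpace ℝ (Fin 3), ∀ s : ℝ,
      Integrable (fun t ↦ g t * exp (s * ⟪u, t⟫)) (gaussianModel S ν₀))
    (h : ∀ᶠ s in 𝓝 (0 : ℝ), ∫ t, g t ∂(gaussianModel S (ν₀ + s • d)) = 0) (s : ℝ) :
    ∫ t, g t ∂(gaussianModel S (ν₀ + s • d)) = 0 := by
  obtain ⟨θ, rfl⟩ : ∃ θ, Matrix.toEuclideanCLM (𝕜 := ℝ) S θ = d := by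
    refine ⟨Matrix.toEuclideanCLM (𝕜 := ℝ) S⁻¹ d, ?_⟩
    rw [← ContinuousLinearMap.comp_apply, ← ContinuousLinearMap.mul_def, ← map_mul,
      Matrix.mul_nonsing_inv _ ((Matrix.isUnit_iff_isUnit_det _).1 hS.isUnit), map_one]
    rfl
  have key (s : ℝ) : ∫ t, g t ∂(gaussianModel S
      (ν₀ + s • Matrix.toEuclideanCLM (𝕜 := ℝ) S θ)) = 0 ↔
      ∫ t, g t * exp (s * ⟪θ, t⟫) ∂(gaussianModel S ν₀) = 0 := by
    have := integral_multivariateGaussian_add hS.posSemidef ν₀ (s • θ) g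
    rw [map_smul, integral_exp_inner_multivariateGaussian hS.posSemidef] at this
    rw [gaussianModel, this, div_eq_zero_iff, or_iff_left (exp_pos _).ne']
    simp only [real_inner_smul_left, gaussianModel]
  simp only [key] at h ⊢
  exact integral_mul_exp_eq_zero hg (by fun_prop) (hint θ) h s

lemma isOpen_interiorMeans : IsOpen interiorMeans := by
  have h (i : Fin 3) : Continuous fun μ : EuclideanSpace ℝ (Fin 3) ↦ μ i := by fun_prop
  exact (isOpen_lt continuous_const (h 0)).inter
    ((isOpen_lt continuous_const (h 2)).inter (isOpen_lt ((h 1).pow 2) ((h 0).mul (h 2))))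

lemma eventually_add_smul_mem_interiorMeans {ν d : EuclideanSpace ℝ (Fin 3)}
    (hν : ν ∈ interiorMeans) : ∀ᶠ s in 𝓝 (0 : ℝ), ν + s • d ∈ interiorMeans := by
  have hc : Continuous fun s : ℝ ↦ ν + s • d := by fun_prop
  exact hc.continuousAt.eventually_mem (isOpen_interiorMeans.mem_nhds (by simpa using hν))

variable {α : ℝ} {ψ : EuclideanSpace ℝ (Fin 3) → ℝ}

/-! ### Side conditions forced by unbiasedness -/

lemma IsUnbiasedTest.integral_of_mem_nullMeans (hS : S.PosDef)
    (hψ : IsUnbiasedTest (gaussianModel S) nullMeans altMeans α ψ)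
    {ν : EuclideanSpace ℝ (Fin 3)} (hν : ν ∈ nullMeans) :
    ∫ t, ψ t ∂(gaussianModel S ν) = α ∧
      ∫ t, ψ t * ⟪scoreVector S, t⟫ ∂(gaussianModel S ν) = 0 := by
  have hS11 : 0 < √(S 1 1) := sqrt_pos.2 hS.diag_pos
  have hd := hasDerivAt_integral_mul_exp (P := gaussianModel S ν)
    (X := fun t ↦ ⟪scoreVector S, t⟫) hψ.isTest.measurable (fun t ↦ (hψ.isTest.mem_Icc t).1)
    (fun s ↦ hψ.isTest.integrable_mul (integrable_exp_mul_gaussianModel hS ν _ s))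
  set G : ℝ → ℝ := fun s ↦ ∫ t, ψ t * exp (s * ⟪scoreVector S, t⟫) ∂(gaussianModel S ν) with hG
  have hG0 : G 0 = ∫ t, ψ t ∂(gaussianModel S ν) := by simp [hG]
  have hge : ∀ᶠ s in 𝓝[≠] (0 : ℝ), 0 ≤ G s - α * exp (s ^ 2 / 2) := by
    filter_upwards [self_mem_nhdsWithin,
      (eventually_add_smul_mem_interiorMeans (d := scoreShift S) hν.1).filter_mono
        nhdsWithin_le_nhds] with s hs hmem
    have hs : s ≠ 0 := hs
    have := hψ.unbiased _ ⟨hmem, by simp [hν.2, scoreShift_apply_one hS, hs, hS11.ne']⟩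
    rw [power_add_scoreShift hS hν.2, le_div_iff₀ (exp_pos _)] at this
    exact sub_nonneg.2 this
  have hH : HasDerivAt (fun s ↦ G s - α * exp (s ^ 2 / 2))
      (∫ t, ψ t * ⟪scoreVector S, t⟫ ∂(gaussianModel S ν)) 0 := by
    have h2 : HasDerivAt (fun s : ℝ ↦ α * exp (s ^ 2 / 2)) 0 0 := by
      have := ((((hasDerivAt_id (0 : ℝ)).pow 2).div_const 2).exp).const_mul α
      simpa using this
    have := hd.sub h2
    rwa [sub_zero] at this
  have h0 : ∫ t, ψ t ∂(gaussianModel S ν) = α := by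
    refine le_antisymm (hψ.level ν hν) ?_
    have := ge_of_tendsto (hH.continuousAt.tendsto.mono_left nhdsWithin_le_nhds) hge
    simp only [hG0] at this
    simpa using this
  -- `G s - α * exp (s ^ 2 / 2)` vanishes at 0 and is nonnegative nearby, so its derivative at 0 is
  -- zero.
  refine ⟨h0, IsLocalMin.hasDerivAt_eq_zero ?_ hH⟩
  have hz : G 0 - α * exp ((0 : ℝ) ^ 2 / 2) = 0 := by simp [hG0, h0]
  rw [eventually_nhdsWithin_iff] at hge
  filter_upwards [hge] with s hs
  rw [hz]
  by_cases h : s = 0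
  · rw [h, hz]
  · exact hs h

/-- Needed because sliding an alternative back to `ν 1 = 0` along `scoreShift S` may leave
`interiorMeans`. The line from the null point `(1, 0, 1)` to `ν` stays in the null near its start.
-/
lemma IsUnbiasedTest.integral_of_apply_one_eq_zero (hS : S.PosDef)
    (hψ : IsUnbiasedTest (gaussianModel S) nullMeans altMeans α ψ)
    {ν : EuclideanSpace ℝ (Fin 3)} (hν : ν 1 = 0) :
    ∫ t, ψ t ∂(gaussianModel S ν) = α ∧
      ∫ t, ψ t * ⟪scoreVector S, t⟫ ∂(gaussianModel S ν) = 0 := by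
  set ν₀ : EuclideanSpace ℝ (Fin 3) := !₂[1, 0, 1] with hν₀
  have hmem : ν₀ ∈ interiorMeans := by simp [interiorMeans, hν₀]
  have hnull : ∀ᶠ s in 𝓝 (0 : ℝ), ν₀ + s • (ν - ν₀) ∈ nullMeans := by
    filter_upwards [eventually_add_smul_mem_interiorMeans (d := ν - ν₀) hmem] with s hs
    exact ⟨hs, by simp [hν₀, hν]⟩
  have hline : ν₀ + (1 : ℝ) • (ν - ν₀) = ν := by simp
  have hm := hψ.isTest.measurable
  constructor
  · have := integral_eq_zero_of_line hS (ν₀ := ν₀) (d := ν - ν₀) (g := fun t ↦ ψ t - α)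
      (by fun_prop) (fun u s ↦ ?_) ?_ 1
    · rw [hline, integral_sub hψ.isTest.integrable (integrable_const _)] at this
      simpa [sub_eq_zero] using this
    · simp_rw [sub_mul]
      exact (hψ.isTest.integrable_mul (integrable_exp_mul_gaussianModel hS _ _ s)).sub
        ((integrable_exp_mul_gaussianModel hS _ _ s).const_mul α)
    · filter_upwards [hnull] with s hs
      rw [integral_sub hψ.isTest.integrable (integrable_const _),
        (hψ.integral_of_mem_nullMeans hS hs).1]
      simp
  · have := integral_eq_zero_of_line hS (ν₀ := ν₀) (d := ν - ν₀)
      (g := fun t ↦ ψ t * ⟪scoreVector S, t⟫) (by fun_prop) (fun u s ↦ ?_) ?_ 1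
    · rwa [hline] at this
    · simp_rw [mul_assoc]
      exact hψ.isTest.integrable_mul (integrable_inner_mul_exp_gaussianModel hS _ _ u s)
    · filter_upwards [hnull] with s hs
      exact (hψ.integral_of_mem_nullMeans hS hs).2

/-! ### Optimality of the LM test -/

lemma inner_scoreVector_sq (hS : S.PosDef) (t : EuclideanSpace ℝ (Fin 3)) :
    ⟪scoreVector S, t⟫ ^ 2 = t 1 ^ 2 / S 1 1 := by
  have h : 0 < S 1 1 := hS.diag_pos
  rw [inner_scoreVector, div_pow, sq_sqrt h.le]

/-- The LM test as a function of the standardized LM statistic. -/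
noncomputable def twoSidedTest (α y : ℝ) : ℝ :=
  {y : ℝ | normalQuantile (1 - α / 2) ^ 2 < y ^ 2}.indicator 1 y

lemma measurableSet_rejection (α : ℝ) :
    MeasurableSet {y : ℝ | normalQuantile (1 - α / 2) ^ 2 < y ^ 2} :=
  measurableSet_lt measurable_const (by fun_prop)

lemma measurable_twoSidedTest (α : ℝ) : Measurable (twoSidedTest α) :=
  (measurable_one.indicator (measurableSet_rejection α))

lemma lmTest_eq (hS : S.PosDef) (α : ℝ) (t : EuclideanSpace ℝ (Fin 3)) :
    lmTest S α t = twoSidedTest α ⟪scoreVector S, t⟫ := by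
  simp [lmTest, twoSidedTest, indicator_apply, inner_scoreVector_sq hS]

lemma isTest_lmTest (hS : S.PosDef) (α : ℝ) : IsTest (lmTest S α) where
  measurable := by
    rw [funext (lmTest_eq hS α)]
    exact (measurable_twoSidedTest α).comp (by fun_prop)
  mem_Icc t := by
    unfold lmTest
    split_ifs <;> simp

lemma integral_lmTest (hS : S.PosDef) (hα₀ : 0 < α) (hα₁ : α < 1)
    {ν : EuclideanSpace ℝ (Fin 3)} (hν : ν 1 = 0) :
    ∫ t, lmTest S α t ∂(gaussianModel S ν) = α := by
  simp_rw [lmTest_eq hS]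
  rw [← integral_map (φ := fun t ↦ ⟪scoreVector S, t⟫) (f := twoSidedTest α) (by fun_prop)
    (measurable_twoSidedTest α).aestronglyMeasurable, map_inner_scoreVector hS hν]
  unfold twoSidedTest
  rw [integral_indicator_one (measurableSet_rejection α), gaussianReal_real_sq_gt hα₀ hα₁]

lemma integral_lmTest_mul_inner (hS : S.PosDef) (α : ℝ)
    {ν : EuclideanSpace ℝ (Fin 3)} (hν : ν 1 = 0) :
    ∫ t, lmTest S α t * ⟪scoreVector S, t⟫ ∂(gaussianModel S ν) = 0 := by
  have hm : Measurable fun y ↦ twoSidedTest α y * y :=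
    (measurable_twoSidedTest α).mul measurable_id
  simp_rw [lmTest_eq hS]
  rw [← integral_map (φ := fun t ↦ ⟪scoreVector S, t⟫) (f := fun y ↦ twoSidedTest α y * y)
    (by fun_prop) hm.aestronglyMeasurable, map_inner_scoreVector hS hν]
  -- The integrand is odd and the standard normal law symmetric.
  have hneg : ∫ y, twoSidedTest α y * y ∂(gaussianReal 0 1) =
      ∫ y, -(twoSidedTest α y * y) ∂(gaussianReal 0 1) := by
    conv_lhs => rw [← neg_zero, ← gaussianReal_map_neg]
    rw [integral_map (by fun_prop) hm.aestronglyMeasurable]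
    simp [twoSidedTest, indicator_apply]
  rw [integral_neg] at hneg
  linarith

/-- Among the tests satisfying the two side conditions under `ν`, the LM test has the largest power
along the line through `ν` in the direction of the score, and is essentially the only such test. -/
lemma power_le_power_lmTest (hS : S.PosDef) (hα₀ : 0 < α) (hα₁ : α < 1) (hψ : IsTest ψ)
    {ν : EuclideanSpace ℝ (Fin 3)} (hν : ν 1 = 0) {s : ℝ} (hs : s ≠ 0)
    (h0 : ∫ t, ψ t ∂(gaussianModel S ν) = α)
    (h1 : ∫ t, ψ t * ⟪scoreVector S, t⟫ ∂(gaussianModel S ν) = 0) :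
    power (gaussianModel S) ψ (ν + s • scoreShift S) ≤
        power (gaussianModel S) (lmTest S α) (ν + s • scoreShift S) ∧
      (power (gaussianModel S) ψ (ν + s • scoreShift S) =
        power (gaussianModel S) (lmTest S α) (ν + s • scoreShift S) →
        ψ =ᵐ[gaussianModel S ν] lmTest S α) := by
  have hY : ∀ᵐ t ∂(gaussianModel S ν),
      ⟪scoreVector S, t⟫ ^ 2 ≠ normalQuantile (1 - α / 2) ^ 2 := by
    have hfin : {y : ℝ | y ^ 2 = normalQuantile (1 - α / 2) ^ 2}.Countable := by
      simp only [sq_eq_sq_iff_eq_or_eq_neg]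
      exact ((countable_singleton _).union (countable_singleton _))
    have hae : ∀ᵐ y ∂(gaussianReal 0 1), y ^ 2 ≠ normalQuantile (1 - α / 2) ^ 2 := by
      have := nullSingletonClass_gaussianReal (μ := 0) (v := 1) one_ne_zero
      exact hfin.ae_notMem _
    rw [← map_inner_scoreVector hS hν] at hae
    exact ae_of_ae_map (f := fun t ↦ ⟪scoreVector S, t⟫) (by fun_prop) hae
  have := integral_mul_exp_le_of_two_sided (isTest_lmTest hS α) hψ
    (normalQuantile_pos (p := 1 - α / 2) (by linarith) (by linarith)) hs
    (fun t ht ↦ by simp [lmTest, ← inner_scoreVector_sq hS, ht])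
    (fun t ht ↦ by simp [lmTest, ← inner_scoreVector_sq hS, ht.le]) hY
    (integrable_inner_gaussianModel hS ν _) (integrable_exp_mul_gaussianModel hS ν _ s)
    (h0.trans (integral_lmTest hS hα₀ hα₁ hν).symm)
    (h1.trans (integral_lmTest_mul_inner hS α hν).symm)
  rw [power_add_scoreShift hS hν, power_add_scoreShift hS hν, div_left_inj' (exp_pos _).ne']
  exact ⟨div_le_div_of_nonneg_right this.1 (exp_pos _).le, this.2⟩

lemma exists_eq_add_smul_scoreShift (hS : S.PosDef) (μ : EuclideanSpace ℝ (Fin 3)) :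
    ∃ ν : EuclideanSpace ℝ (Fin 3), ∃ s : ℝ,
      ν 1 = 0 ∧ (μ 1 ≠ 0 → s ≠ 0) ∧ μ = ν + s • scoreShift S := by
  have h : √(S 1 1) ≠ 0 := (sqrt_pos.2 hS.diag_pos).ne'
  refine ⟨μ - (μ 1 / √(S 1 1)) • scoreShift S, μ 1 / √(S 1 1), ?_, fun hμ ↦ div_ne_zero hμ h,
    by simp⟩
  simp [scoreShift_apply_one hS, h]

lemma absolutelyContinuous_gaussianModel (hS : S.PosDef) (μ ν : EuclideanSpace ℝ (Fin 3)) :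
    gaussianModel S μ ≪ gaussianModel S ν := by
  have : μ = ν + Matrix.toEuclideanCLM (𝕜 := ℝ) S
      (Matrix.toEuclideanCLM (𝕜 := ℝ) S⁻¹ (μ - ν)) := by
    rw [← ContinuousLinearMap.comp_apply, ← ContinuousLinearMap.mul_def, ← map_mul,
      Matrix.mul_nonsing_inv _ ((Matrix.isUnit_iff_isUnit_det _).1 hS.isUnit), map_one]
    simp
  rw [this, gaussianModel, multivariateGaussian_add_eq_tilted hS.posSemidef]
  exact tilted_absolutelyContinuous _ _

lemma IsUnbiasedTest.power_le_power_lmTest (hS : S.PosDef) (hα₀ : 0 < α) (hα₁ : α < 1)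
    (hψ : IsUnbiasedTest (gaussianModel S) nullMeans altMeans α ψ)
    {μ : EuclideanSpace ℝ (Fin 3)} (hμ : μ 1 ≠ 0) :
    power (gaussianModel S) ψ μ ≤ power (gaussianModel S) (lmTest S α) μ ∧
      (power (gaussianModel S) ψ μ = power (gaussianModel S) (lmTest S α) μ →
        ∀ μ', ψ =ᵐ[gaussianModel S μ'] lmTest S α) := by
  obtain ⟨ν, s, hν, hs, rfl⟩ := exists_eq_add_smul_scoreShift hS μ
  obtain ⟨h0, h1⟩ := hψ.integral_of_apply_one_eq_zero hS hν
  have := UMPU.power_le_power_lmTest hS hα₀ hα₁ hψ.isTest hν (hs hμ) h0 h1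
  exact ⟨this.1, fun h μ' ↦ (absolutelyContinuous_gaussianModel hS μ' ν).ae_eq (this.2 h)⟩

/-- The constant test `α` satisfies both side conditions, so the LM test is at least as powerful. -/
lemma le_power_lmTest (hS : S.PosDef) (hα₀ : 0 < α) (hα₁ : α < 1)
    {μ : EuclideanSpace ℝ (Fin 3)} (hμ : μ 1 ≠ 0) :
    α ≤ power (gaussianModel S) (lmTest S α) μ := by
  obtain ⟨ν, s, hν, hs, rfl⟩ := exists_eq_add_smul_scoreShift hS μ
  have hY : ∫ t, ⟪scoreVector S, t⟫ ∂(gaussianModel S ν) = 0 := by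
    rw [← integral_map (φ := fun t ↦ ⟪scoreVector S, t⟫) (f := fun y ↦ y) (by fun_prop)
      (by fun_prop), map_inner_scoreVector hS hν, integral_id_gaussianReal]
  have := (power_le_power_lmTest hS hα₀ hα₁ (ψ := fun _ ↦ α)
    ⟨measurable_const, fun _ ↦ ⟨hα₀.le, hα₁.le⟩⟩ hν (hs hμ) (by simp)
    (by rw [integral_const_mul, hY, mul_zero])).1
  simpa [power] using this

lemma isUnbiasedTest_lmTest (hS : S.PosDef) (hα₀ : 0 < α) (hα₁ : α < 1) :
    IsUnbiasedTest (gaussianModel S) nullMeans altMeans α (lmTest S α) where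
  isTest := isTest_lmTest hS α
  level _ hμ := (integral_lmTest hS hα₀ hα₁ hμ.2).le
  unbiased _ hμ := le_power_lmTest hS hα₀ hα₁ hμ.2

end LMModel

end UMPU

theorem proposition1 (S : Matrix (Fin 3) (Fin 3) ℝ) (hS : S.PosDef)
    (α : ℝ) (hα₀ : 0 < α) (hα₁ : α < 1) :
    UMPU.IsUMPUTest (UMPU.gaussianModel S) UMPU.nullMeans UMPU.altMeans α (UMPU.lmTest S α) ∧
    (∀ μ ∈ UMPU.nullMeans, UMPU.power (UMPU.gaussianModel S) (UMPU.lmTest S α) μ = α) ∧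
    (∀ φ : EuclideanSpace ℝ (Fin 3) → ℝ,
      UMPU.IsUMPUTest (UMPU.gaussianModel S) UMPU.nullMeans UMPU.altMeans α φ →
      ∀ μ ∈ UMPU.interiorMeans, φ =ᵐ[UMPU.gaussianModel S μ] UMPU.lmTest S α) := by
  have hLM := UMPU.isUnbiasedTest_lmTest hS hα₀ hα₁
  refine ⟨⟨hLM, fun ψ hψ μ hμ ↦ (hψ.power_le_power_lmTest hS hα₀ hα₁ hμ.2).1⟩,
    fun μ hμ ↦ UMPU.integral_lmTest hS hα₀ hα₁ hμ.2, fun φ hφ μ _ ↦ ?_⟩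
  -- Equality of power at a single alternative already forces almost sure equality under every mean.
  have hmem : !₂[1, 1 / 2, 1] ∈ UMPU.altMeans := by
    have h2 : ![(1 : ℝ), 1 / 2, 1] 2 = 1 := rfl
    refine ⟨⟨?_, ?_, ?_⟩, ?_⟩ <;> norm_num [h2]
  have h := hφ.isUnbiasedTest.power_le_power_lmTest hS hα₀ hα₁ hmem.2
  exact h.2 (le_antisymm h.1 (hφ.most_powerful _ hLM _ hmem)) μ
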